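/- **Definitions.** A cardinal is identified with the set of ordinals below it, and $[X]^{<\theta}$, $[X]^{\le\kappa}$ denote the families of subsets of $X$ of cardinality $<\theta$, resp. $\le\kappa$. Let $\kappa\ge\theta$ be infinite cardinals. A *triple* is $(\kappa,K^*,c\ell^*)$ with $K^*\subseteq\mathcal P(\kappa)$ and $c\ell^*:[\kappa]^{<\theta}\to\mathcal P(\kappa)$ a function. For such a triple let $$I_1=\{(a,b): a\in[\kappa]^{<\theta},\ b\in K^*,\ b\subseteq c\ell^*(a)\},\qquad I_0=\{(a,b): a\subseteq\kappa,\ b\in K^*,\ a\cap b=\emptyset\}.$$ Let $\mathbf K$ be a set of triples. A cardinal $\mu$ is *$(\mathbf K,\theta)$-approximate* if there is $\langle\mathcal P_\alpha:\alpha\in C\rangle$ such that: (i) $C$ is a club (closed unbounded subset) of $\mu$; (ii) for $\alpha\in C$, $\mathcal P_\alpha\subseteq[\alpha]^{<\theta}$ and $|\mathcal P_\alpha|\le\min(C\setminus(\alpha+1))$; (iii) for every triple in $\mathbf K$, with $I_0,I_1$ as above, and every one-to-one function $f:\kappa\to\mu$, there is $\alpha\in C$ for which one of the following holds: - (a) for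 some $c\in\mathcal P_\alpha$ and $(a,b)\in I_1$: $f(i)\in c$ for all $i\in a$, and $f(i)\ge\alpha$ for all $i\in b$; - (b) for some $(a,b)\in I_0$: every $i<\kappa$ with $f(i)<\alpha$ is in $a$, and $\alpha\le f(i)<\min(C\setminus(\alpha+1))$ for all $i\in b$. For a family $K$ of subsets of $\lambda$ and $A\subseteq\lambda$, a *$[K,\sigma]$-colouring of $A$* is a function $\mathbf c:A\to\sigma$ such that $\mathrm{Rang}(\mathbf c\restriction a)=\sigma$ for every $a\in K$ with $a\subseteq A$. **Lemma 3.2.** Assume: (a) $\lambda>\chi\ge\kappa\ge\theta$ and $\sigma$ are infinite cardinals, and $2^{<\theta}\le\chi$ (that is, $2^{\tau}\le\chi$ for every cardinal $\tau<\theta$); (b) $K\subseteq[\lambda]^{\le\kappa}$ and $c\ell$ is a partial function from $[\lambda]^{<\theta}$ to $K$; (c) $\mathbf K$ is a set of triples $(\kappa,K^*,c\ell^*)$ as above; (d) for every $b\in K$ there are $(\kappa,K^*,c\ell^*)\in\mathbf K$ and a one-to-one function $f:\kappa\to b$ such that $f[b']\in K$ for every $b'\in K^*$, and for every $a'\in[\kappa]^{<\theta}$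 the value $c\ell(f[a'])$ is defined and $c\ell(f[a'])\supseteq f[c\ell^*(a')]$; (e) for every $A\in[\lambda]^{\le\chi}$ there is a $[K,\sigma]$-colouring of $A$; (f) every cardinal $\mu$ with $\chi<\mu\le\lambda$ is $(\mathbf K,\theta)$-approximate. Then there is a $[K,\sigma]$-colouring of $\lambda$. -/

import Mathlib

open Cardinal

universe u

namespace ClosureColouring

/-- The cardinal `κ`, regarded as the well-ordered set of all ordinals below it. -/
abbrev Pts (κ : Cardinal.{u}) : Type u := κ.ord.ToType

/-- The family `[κ]^{<θ}` of the subsets of `κ` of cardinality less than `θ`. -/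
abbrev SmallSets (κ θ : Cardinal.{u}) : Type u := {a : Set (Pts κ) // #a < θ}

/-- A triple `(κ, K, cl)`, where `K` is a family of subsets of `κ` and `cl` is a function
from `[κ]^{<θ}` to the power set of `κ`. -/
structure Triple (κ θ : Cardinal.{u}) where
  /-- the family of subsets of `κ` -/
  K : Set (Set (Pts κ))
  /-- the operation on the small subsets of `κ` -/
  cl : SmallSets κ θ → Set (Pts κ)

/-- The pairs `(a, b)` with `a ∈ [κ]^{<θ}`, `b ∈ K` and `b ⊆ cl a`. -/
def Triple.I₁ {κ θ : Cardinal.{u}} (T : Triple κ θ) : Set (Set (Pts κ) × Set (Pts κ)) :=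
  {p | p.2 ∈ T.K ∧ ∃ h : #p.1 < θ, p.2 ⊆ T.cl ⟨p.1, h⟩}

/-- The pairs `(a, b)` with `a ⊆ κ`, `b ∈ K` and `a ∩ b = ∅`. -/
def Triple.I₀ {κ θ : Cardinal.{u}} (T : Triple κ θ) : Set (Set (Pts κ) × Set (Pts κ)) :=
  {p | p.2 ∈ T.K ∧ p.1 ∩ p.2 = ∅}

/-- `γ = Min (C \ (α + 1))`. -/
def IsNext {μ : Cardinal.{u}} (C : Set (Pts μ)) (α γ : Pts μ) : Prop :=
  IsLeast {γ | γ ∈ C ∧ α < γ} γ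

/-- Clauses (i) and (ii): `C` is a club of `μ` and, for `α ∈ C`, the family `P α` consists of
subsets of `α` of cardinality less than `θ`, and `|P α| ≤ Min (C \ (α + 1))`.
(Only the values `P α` for `α ∈ C` matter.) -/
structure IsSystem (μ θ : Cardinal.{u}) (C : Set (Pts μ)) (P : Pts μ → Set (Set (Pts μ))) :
    Prop where
  isClub : IsClub C
  subset : ∀ α ∈ C, ∀ c ∈ P α, c ⊆ Set.Iio α
  small : ∀ α ∈ C, ∀ c ∈ P α, #c < θ
  card_le : ∀ α ∈ C, ∀ γ, IsNext C α γ → #(P α) ≤ #(Set.Iio γ)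

/-- Clause (iii) for the pair of sets of pairs `(I₀, I₁)`. -/
def Catches {κ μ : Cardinal.{u}} (I₀ I₁ : Set (Set (Pts κ) × Set (Pts κ)))
    (C : Set (Pts μ)) (P : Pts μ → Set (Set (Pts μ))) : Prop :=
  ∀ f : Pts κ → Pts μ, Function.Injective f → ∃ α ∈ C,
    (∃ c ∈ P α, ∃ p ∈ I₁, (∀ i ∈ p.1, f i ∈ c) ∧ ∀ i ∈ p.2, α ≤ f i) ∨
    (∃ p ∈ I₀, (∀ i, f i < α → i ∈ p.1) ∧
      ∃ γ, IsNext C α γ ∧ ∀ i ∈ p.2, α ≤ f i ∧ f i < γ)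

/-- `μ` is `(𝒦, θ)`-approximate: a single system serves all the triples in `𝒦`. -/
def IsApproximate {κ θ : Cardinal.{u}} (μ : Cardinal.{u}) (𝒦 : Set (Triple κ θ)) : Prop :=
  ∃ (C : Set (Pts μ)) (P : Pts μ → Set (Set (Pts μ))), IsSystem μ θ C P ∧
    ∀ T ∈ 𝒦, Catches T.I₀ T.I₁ C P

/-- `c : A → σ` is a `[K, σ]`-colouring of `A`: it takes all the values in `σ` on every member
of `K` that is a subset of `A`. -/
def IsColouring {lam σ : Cardinal.{u}} (K : Set (Set (Pts lam))) (A : Set (Pts lam))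
    (c : A → Pts σ) : Prop :=
  ∀ a ∈ K, a ⊆ A → c '' {x | (x : Pts lam) ∈ a} = Set.univ

end ClosureColouring

/-!
By induction on `μ`, every `A` of cardinality `μ ≤ lam` has a colouring. Up to `χ` this is a
hypothesis. Let `μ > χ`, and let `⟨P α : α ∈ C⟩` be a system witnessing that `μ` is approximate.

The set `A` is enlarged to the range of a sequence `h` of length `μ` that is closed under `cl` in a
weak sense: for cofinally many `δ ∈ C`, if `c ∈ P α` with `α < δ`, then `cl x` is contained in
`h '' δ` for every small `x ⊆ h '' c`. There are few points to add, as `c` has at most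
`2 ^< θ ≤ χ` subsets and `|P α|` is at most the successor of `α` in `C`. There is also room for them
if `δ` is a good point, that is, `[α, δ)` has the full cardinality `|δ|` for all `α ∈ C` below `δ`;
good points are cofinal (`exists_goodPoint_gt`) and `exists_closed_enumeration` builds `h`.

The good points cut the range of `h` into blocks of cardinality less than `μ`, which have colourings
by induction; these are glued. If `b ∈ K` is contained in the range of `h`, let `f : κ → b` be the
copy of a triple, and let `α` be the point that catches the indices (under `h`) of the points `f i`.
In clause (a) the closure of `h` puts the copy of some `b' ∈ K*` before the first good point above
`α`, while its indices are at least `α`; in clause (b) the indices lie between `α` and its successor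
in `C`. In both cases a member `f '' b'` of `K` inside `b` lies in one block
(`exists_mem_subset_block`), so already `f '' b'` takes all the colours.
-/

namespace ClosureColouring

open Set Function

/-! ### Choices and bookkeeping along a well-order -/

theorem mk_Iio_pts_lt {μ : Cardinal.{u}} (i : Pts μ) : #(Iio i) < μ := by
  simpa using mk_Iio_lt i

/-- At most `ν` sets, each with at least `ν` elements, have an injective choice function: along a
well-ordering of type `ν`, fewer than `ν` elements are excluded at each step. -/
theorem exists_injective_choice {ι X : Type u} {ν : Cardinal.{u}} (hι : #ι ≤ ν)
    (S : ι → Set X) (hS : ∀ i, ν ≤ #(S i)) :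
    ∃ j : ι → X, Injective j ∧ ∀ i, j i ∈ S i := by
  classical
  obtain ⟨e⟩ : Nonempty (ι ↪ Pts ν) := by rwa [← Cardinal.le_def, mk_ord_toType]
  have wf : WellFounded (fun i i' : ι => e i < e i') := InvImage.wf e wellFounded_lt
  have avoid : ∀ (i : ι) (g : ∀ i', e i' < e i → X), ∃ x ∈ S i, ∀ i' h, g i' h ≠ x := by
    intro i g
    by_contra! hcon
    have hsub : S i ⊆ range fun p : {i' // e i' < e i} => g p.1 p.2 := fun x hx => by
      obtain ⟨i', h, rfl⟩ := hcon x hx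
      exact ⟨⟨i', h⟩, rfl⟩
    have hle : #{i' // e i' < e i} ≤ #(Iio (e i)) :=
      mk_le_of_injective (f := fun p => (⟨e p.1, p.2⟩ : Iio (e i))) fun p q h =>
        Subtype.ext (e.injective (congrArg Subtype.val h))
    exact (((hS i).trans (mk_le_mk_of_subset hsub)).trans (mk_range_le.trans hle)).not_gt
      (mk_Iio_pts_lt _)
  choose pick hmem hne using avoid
  have heq : ∀ i, wf.fix pick i = pick i fun i' _ => wf.fix pick i' := fun i => wf.fix_eq pick i
  have hlt : ∀ i i', e i' < e i → wf.fix pick i' ≠ wf.fix pick i := fun i i' h => by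
    rw [heq i]
    exact hne i (fun i' _ => wf.fix pick i') i' h
  refine ⟨wf.fix pick, fun i i' h => ?_, fun i => heq i ▸ hmem i _⟩
  rcases lt_trichotomy (e i) (e i') with h' | h' | h'
  · exact (hlt _ _ h' h).elim
  · exact e.injective h'
  · exact (hlt _ _ h' h.symm).elim

/-- Bookkeeping along a well-order. A task `r` asks that the value `Φ r h`, which depends on `h`
only below `a r`, be taken by `h`. If below each `δ ∈ G` there are at most `|δ|` tasks and each of
them leaves `|δ|` places in `[a r, δ)`, then a single `h` performs every task before every `δ ∈ G`
above `a r`. -/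
theorem exists_enumeration_of_tasks {W L R : Type u} [LinearOrder W] [WellFoundedLT W]
    [Nonempty L] (G : Set W) (a : R → W) (Φ : R → (W → L) → L)
    (hΦ : ∀ r h h', (∀ i < a r, h i = h' i) → Φ r h = Φ r h')
    (hG : ∀ r, ∃ δ ∈ G, a r < δ)
    (hcard : ∀ δ ∈ G, #{r | a r < δ} ≤ #(Iio δ))
    (hlarge : ∀ δ ∈ G, ∀ r, a r < δ → #(Iio δ) ≤ #(Ico (a r) δ)) :
    ∃ h : W → L, ∀ δ ∈ G, ∀ r, a r < δ → ∃ i < δ, h i = Φ r h := by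
  classical
  have hleast : ∀ r, ∃ δ, IsLeast {δ | δ ∈ G ∧ a r < δ} δ := fun r =>
    ⟨_, wellFounded_lt.min_mem _ (hG r), fun _ hx => wellFounded_lt.min_le hx⟩
  choose d hd using hleast
  -- For each `δ`, distinct places in `[a r, δ)` are reserved for the tasks `r` whose first deadline
  -- is `δ`.
  have hJ : ∀ δ : G, ∃ J : {r // d r = δ} → W, Injective J ∧
      ∀ r : {r // d r = δ}, J r ∈ Ico (a r.1) (δ : W) := by
    intro δ
    refine exists_injective_choice (ν := #(Iio (δ : W))) ?_
      (fun r : {r // d r = δ} => Ico (a r.1) (δ : W)) ?_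
    · refine le_trans ?_ (hcard δ δ.2)
      refine mk_le_mk_of_subset fun r (hr : d r = δ) => ?_
      have := (hd r).1.2
      rwa [hr] at this
    · intro r
      have := (hd r.1).1.2
      rw [r.2] at this
      exact hlarge δ δ.2 r this
  choose J hJinj hJmem using hJ
  let j : R → W := fun r => J ⟨d r, (hd r).1.1⟩ ⟨r, rfl⟩
  have hj : ∀ r, a r ≤ j r ∧ j r < d r := fun r => hJmem ⟨d r, (hd r).1.1⟩ ⟨r, rfl⟩
  -- Tasks with different deadlines use disjoint intervals: if `d r < d r'`, then `d r ≤ a r'`.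
  have hjlt : ∀ r r', d r < d r' → j r < j r' := fun r r' h => by
    have h1 : d r ≤ a r' := by
      by_contra! h2
      exact ((hd r').2 ⟨(hd r).1.1, h2⟩).not_gt h
    exact ((hj r).2.trans_le h1).trans_le (hj r').1
  have hjinj : Injective j := by
    intro r r' h
    rcases lt_trichotomy (d r) (d r') with h' | h' | h'
    · exact ((hjlt _ _ h').ne h).elim
    · have key : ∀ (δ : G) (hr : d r = δ) (hr' : d r' = δ), J δ ⟨r, hr⟩ = J δ ⟨r', hr'⟩ := by
        have hval : ∀ (r : R) (δ : G) (hr : d r = δ), j r = J δ ⟨r, hr⟩ := by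
          rintro r ⟨δ, hδ⟩ hr
          obtain rfl : d r = δ := hr
          rfl
        intro δ hr hr'
        rw [← hval, ← hval, h]
      exact congrArg Subtype.val (hJinj _ (key ⟨d r', (hd r').1.1⟩ h' rfl))
    · exact ((hjlt _ _ h').ne h.symm).elim
  -- `h i` is the value required by the task with place `i`, if there is one. Since `a r ≤ j r`, the
  -- arbitrary values that the recursion puts at places `≥ i` do not affect it.
  let x₀ : L := Classical.arbitrary L
  let step : ∀ i : W, (∀ i', i' < i → L) → L := fun i g =>
    if hi : ∃ r, j r = i then Φ hi.choose fun i' => if h : i' < i then g i' h else x₀ else x₀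
  let wf : WellFounded (fun i i' : W => i < i') := wellFounded_lt
  refine ⟨wf.fix step, fun δ hδ r hr => ⟨j r, (hj r).2.trans_le ((hd r).2 ⟨hδ, hr⟩), ?_⟩⟩
  have hex : ∃ r', j r' = j r := ⟨r, rfl⟩
  rw [wf.fix_eq]
  simp only [step]
  rw [dif_pos hex, hjinj hex.choose_spec]
  refine hΦ _ _ _ fun i hi => ?_
  rw [dif_pos (hi.trans_le (hj r).1)]

/-- A final segment of a well-order with more than `ν` elements has an initial segment with at least
`ν` of them, namely the one of order type `ν`. -/
theorem exists_le_mk_Ico {W : Type u} [LinearOrder W] [WellFoundedLT W] {ν : Cardinal.{u}}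
    (β : W) (h : ν < #(Ici β)) : ∃ γ, β ≤ γ ∧ ν ≤ #(Ico β γ) := by
  have hlt : ν.ord < Ordinal.type (α := Ici β) (· < ·) := by
    rw [← not_le]
    intro h'
    have := Ordinal.card_le_card h'
    rw [card_ord, Ordinal.card_type] at this
    exact this.not_gt h
  obtain ⟨x, hx⟩ := Ordinal.typein_surj (α := Ici β) (· < ·) hlt
  refine ⟨x, x.2, ?_⟩
  have := congrArg Ordinal.card hx
  rw [Ordinal.card_typein, card_ord] at this
  rw [← this]
  exact mk_le_of_injective (f := fun y => (⟨y.1.1, y.1.2, y.2⟩ : Ico β x.1)) fun y z h =>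
    Subtype.ext (Subtype.ext (congrArg (Subtype.val : Ico β x.1 → W) h :))

theorem exists_subset_range {ι L : Type u} [Nonempty L] (s : Set L) (h : #s ≤ #ι) :
    ∃ e : ι → L, s ⊆ range e := by
  obtain ⟨f⟩ := Cardinal.le_def _ _ |>.1 h
  rcases s.eq_empty_or_nonempty with rfl | ⟨x, hx⟩
  · exact ⟨fun _ => Classical.arbitrary L, empty_subset _⟩
  · have : Nonempty s := ⟨⟨x, hx⟩⟩
    exact ⟨fun i => (invFun f i : s), fun y hy => ⟨f ⟨y, hy⟩, 
      congrArg Subtype.val (leftInverse_invFun f.injective ⟨y, hy⟩)⟩⟩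

/-! ### Good points of a club -/

variable {μ χ : Cardinal.{u}}

theorem mk_Ici (hμ : ℵ₀ ≤ μ) (β : Pts μ) : #(Ici β) = μ := by
  have h := mk_sum_compl (Iio β)
  rw [compl_Iio, mk_ord_toType] at h
  have h1 := mk_Iio_pts_lt β
  refine le_antisymm ((mk_set_le _).trans_eq (mk_ord_toType _)) ?_
  by_contra! h2
  exact (add_lt_of_lt hμ h1 h2).ne h

/-- The points `δ ∈ C` with at least `χ` predecessors such that each interval `[α, δ)` with
`α ∈ C`, `α < δ`, is as large as the set of all predecessors of `δ`. Such a `δ` may be an isolated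
point of `C`; this matters when `μ` has countable cofinality and `C` has no limit points. -/
def goodPoints (χ : Cardinal.{u}) (C : Set (Pts μ)) : Set (Pts μ) :=
  {δ | δ ∈ C ∧ χ ≤ #(Iio δ) ∧ ∀ α ∈ C, α < δ → #(Iio δ) ≤ #(Ico α δ)}

theorem exists_mem_gt {C : Set (Pts μ)} (hμ : ℵ₀ ≤ μ) (hC : IsCofinal C) (β : Pts μ) :
    ∃ δ ∈ C, β < δ := by
  have := noMaxOrder hμ
  obtain ⟨γ, hγ⟩ := exists_gt β
  obtain ⟨δ, hδ, h⟩ := hC γ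
  exact ⟨δ, hδ, hγ.trans_le h⟩

/-- Good points are cofinal: above a `β'` with at least `χ` predecessors, the least `δ ∈ C` for
which `|[β', δ)| ≥ |β'|` is good. -/
theorem exists_goodPoint_gt (hχ : ℵ₀ ≤ χ) (hχμ : χ < μ) {C : Set (Pts μ)} (hC : IsCofinal C)
    (β : Pts μ) : ∃ δ ∈ goodPoints χ C, β < δ := by
  have hμ := hχ.trans hχμ.le
  obtain ⟨β', hβ', hχβ⟩ := exists_le_mk_Ico β (hχμ.trans_eq (mk_Ici hμ β).symm)
  have hχβ' : χ ≤ #(Iio β') := hχβ.trans (mk_le_mk_of_subset fun x hx => hx.2)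
  have hne : {δ | δ ∈ C ∧ β' < δ ∧ #(Iio β') ≤ #(Ico β' δ)}.Nonempty := by
    obtain ⟨γ, hγ, hcard⟩ :=
      exists_le_mk_Ico β' ((mk_Iio_pts_lt β').trans_eq (mk_Ici hμ β').symm)
    obtain ⟨δ, hδ, h⟩ := exists_mem_gt hμ hC γ
    exact ⟨δ, hδ, hγ.trans_lt h, hcard.trans (mk_le_mk_of_subset fun x hx => ⟨hx.1, hx.2.trans h⟩)⟩
  obtain ⟨δ, ⟨hδC, hδ, hcard⟩, hmin⟩ :
      ∃ δ, IsLeast {δ | δ ∈ C ∧ β' < δ ∧ #(Iio β') ≤ #(Ico β' δ)} δ :=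
    ⟨_, wellFounded_lt.min_mem _ hne, fun _ hx => wellFounded_lt.min_le hx⟩
  have hinf : ℵ₀ ≤ #(Ico β' δ) := (hχ.trans hχβ').trans hcard
  have hIio : #(Iio δ) ≤ #(Ico β' δ) := by
    have : Iio δ ⊆ Iio β' ∪ Ico β' δ := fun x hx => by
      rcases lt_or_ge x β' with h | h
      exacts [Or.inl h, Or.inr ⟨h, hx⟩]
    exact (mk_le_mk_of_subset this).trans ((mk_union_le _ _).trans
      (add_le_of_le hinf hcard le_rfl))
  refine ⟨δ, ⟨hδC, hχβ'.trans (mk_le_mk_of_subset fun x hx => lt_trans hx hδ), ?_⟩,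
    hβ'.trans_lt hδ⟩
  intro α hα hαδ
  refine hIio.trans ?_
  rcases le_or_gt α β' with h | h
  · exact mk_le_mk_of_subset fun x hx => ⟨h.trans hx.1, hx.2⟩
  · have h1 : #(Ico β' α) < #(Ico β' δ) := by
      refine lt_of_lt_of_le ?_ hcard
      by_contra! h2
      exact (hmin ⟨hα, h, h2⟩).not_gt hαδ
    by_contra! h2
    have h3 : Ico β' δ ⊆ Ico β' α ∪ Ico α δ := fun x hx => by
      rcases lt_or_ge x α with h | h
      exacts [Or.inl ⟨hx.1, h⟩, Or.inr ⟨h, hx.2⟩]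
    exact ((mk_le_mk_of_subset h3).trans (mk_union_le _ _)).not_gt (add_lt_of_lt hinf h1 h2)

/-! ### The closed enumeration -/

/-- Given an operation `B` with `|B X| ≤ χ` for `|X| < θ`, the range of any sequence `a` of length
`μ` can be enlarged to the range of a sequence `h` of length `μ` such that `B (h '' c)` is
enumerated before the good point `δ`, for each `c ∈ P α` with `α ∈ C` and `α < δ`. -/
theorem exists_closed_enumeration {θ : Cardinal.{u}} {L : Type u} (hχ : ℵ₀ ≤ χ) (hχμ : χ < μ)
    {C : Set (Pts μ)} {P : Pts μ → Set (Set (Pts μ))} (hCP : IsSystem μ θ C P)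
    (B : Set L → Set L) (hB : ∀ X : Set L, #X < θ → #(B X) ≤ χ) (a : Pts μ → L) :
    ∃ h : Pts μ → L, range a ⊆ range h ∧
      ∀ δ ∈ goodPoints χ C, ∀ α ∈ C, α < δ → ∀ c ∈ P α, B (h '' c) ⊆ h '' Iio δ := by
  have hμ := hχ.trans hχμ.le
  have : Nonempty (Pts μ) := by
    rw [← mk_ne_zero_iff, mk_ord_toType]
    exact (aleph0_pos.trans_le hμ).ne'
  have : Nonempty L := ⟨a (Classical.arbitrary _)⟩
  have hcof := hCP.isClub.isCofinal
  have henum : ∀ X : Set L, ∃ e : Pts χ → L, #X < θ → B X ⊆ range e := by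
    intro X
    by_cases hX : #X < θ
    · obtain ⟨e, he⟩ := exists_subset_range (ι := Pts χ) (B X)
        ((hB X hX).trans_eq (mk_ord_toType _).symm)
      exact ⟨e, fun _ => he⟩
    · exact ⟨fun _ => Classical.arbitrary L, fun h => (hX h).elim⟩
  choose e he using henum
  have hnext : ∀ α : C, ∃ γ, IsNext C α γ := fun α =>
    ⟨_, wellFounded_lt.min_mem _ (exists_mem_gt hμ hcof α), fun _ hx => wellFounded_lt.min_le hx⟩
  choose n hn using hnext
  -- There are two kinds of tasks at `α ∈ C`: to enumerate the `ζ`-th point of `B (h '' c)` for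
  -- `c ∈ P α`, and to enumerate the points `a i` with `i` below the successor of `α` in `C`.
  let R : Type u := Σ α : C, (P α × Pts χ) ⊕ Iio (n α)
  let Φ : R → (Pts μ → L) → L := fun r h =>
    Sum.elim (fun q : P r.1 × Pts χ => e (h '' q.1) q.2) (fun i : Iio (n r.1) => a i) r.2
  obtain ⟨h, hh⟩ := exists_enumeration_of_tasks (R := R) (goodPoints χ C) (fun r => r.1) Φ
    (by
      rintro ⟨α, ⟨c, ζ⟩ | i⟩ h h' hhh
      · have : h '' c = h' '' c := image_congr fun i hi => hhh i (hCP.subset α α.2 c c.2 hi)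
        simp only [Φ, Sum.elim_inl, this]
      · rfl)
    (fun r => exists_goodPoint_gt hχ hχμ hcof r.1)
    (by
      rintro δ ⟨hδ, hχδ, -⟩
      have hinf := hχ.trans hχδ
      have hnle : ∀ α : C, α.1 < δ → #(Iio (n α)) ≤ #(Iio δ) := fun α h =>
        mk_le_mk_of_subset (Iio_subset_Iio ((hn α).2 ⟨hδ, h⟩))
      have hsurj : #{r : R | r.1.1 < δ} ≤
          #(Σ α : {α : C // α.1 < δ}, (P α.1 × Pts χ) ⊕ Iio (n α.1)) :=
        mk_le_of_surjective (f := fun s => (⟨⟨s.1.1, s.2⟩, s.1.2⟩ : {r : R | r.1.1 < δ}))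
          fun ⟨⟨α, s⟩, h⟩ => ⟨⟨⟨α, h⟩, s⟩, rfl⟩
      refine hsurj.trans ?_
      rw [mk_sigma]
      have hle : ∀ α : {α : C // α.1 < δ}, #((P α.1 × Pts χ) ⊕ Iio (n α.1)) ≤ #(Iio δ) := by
        intro α
        rw [mk_sum, lift_id, lift_id]
        refine add_le_of_le hinf ?_ (hnle _ α.2)
        rw [mk_prod, lift_id, lift_id, mk_ord_toType]
        exact mul_le_of_le hinf ((hCP.card_le _ α.1.2 _ (hn α.1)).trans (hnle _ α.2)) hχδ
      refine (sum_le_sum _ _ hle).trans ?_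
      rw [sum_const']
      refine mul_le_of_le hinf ?_ le_rfl
      exact mk_le_of_injective (f := fun α => (⟨α.1.1, α.2⟩ : Iio δ)) fun α α' h =>
        Subtype.ext (Subtype.ext (congrArg (Subtype.val : Iio δ → Pts μ) h :)))
    (fun δ hδ r hr => hδ.2.2 _ r.1.2 hr)
  refine ⟨h, ?_, ?_⟩
  · rintro _ ⟨i, rfl⟩
    obtain ⟨α, hα, hiα⟩ := hcof i
    obtain ⟨δ, hδ, hαδ⟩ := exists_goodPoint_gt hχ hχμ hcof α
    obtain ⟨k, -, hk⟩ := hh δ hδ ⟨⟨α, hα⟩, Sum.inr ⟨i, hiα.trans_lt (hn ⟨α, hα⟩).1.2⟩⟩ hαδ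
    exact ⟨k, hk⟩
  · intro δ hδ α hα hαδ c hc x hx
    obtain ⟨ζ, rfl⟩ := he (h '' c) (mk_image_le.trans_lt (hCP.small α hα c hc)) hx
    obtain ⟨k, hk, hkx⟩ := hh δ hδ ⟨⟨α, hα⟩, Sum.inl ⟨⟨c, hc⟩, ζ⟩⟩ hαδ
    exact ⟨k, hk, hkx⟩

/-! ### Gluing colourings of blocks -/

/-- A colouring of `A` that is presented as a function on the whole type, arbitrary outside `A`. -/
def IsTotalColouring {L Y : Type u} (K : Set (Set L)) (A : Set L) (c : L → Y) : Prop :=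
  ∀ b ∈ K, b ⊆ A → c '' b = Set.univ

theorem exists_isColouring_iff {lam σ : Cardinal.{u}} [Nonempty (Pts σ)] {K : Set (Set (Pts lam))}
    {A : Set (Pts lam)} :
    (∃ c : A → Pts σ, IsColouring K A c) ↔ ∃ c : Pts lam → Pts σ, IsTotalColouring K A c := by
  classical
  constructor
  · rintro ⟨c, hc⟩
    refine ⟨fun x => if hx : x ∈ A then c ⟨x, hx⟩ else Classical.arbitrary _, fun b hb hbA => ?_⟩
    rw [← hc b hb hbA]
    ext y
    constructor
    · rintro ⟨x, hx, rfl⟩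
      exact ⟨⟨x, hbA hx⟩, hx, by simp [hbA hx]⟩
    · rintro ⟨x, hx, rfl⟩
      exact ⟨x, hx, by simp⟩
  · rintro ⟨c, hc⟩
    refine ⟨fun x => c x, fun b hb hbA => ?_⟩
    rw [← hc b hb hbA]
    ext y
    constructor
    · rintro ⟨x, hx, rfl⟩
      exact ⟨x, hx, rfl⟩
    · rintro ⟨x, hx, rfl⟩
      exact ⟨⟨x, hbA hx⟩, hx, rfl⟩

/-- The points of `D` whose index under `ρ` is not separated from `i` by a point of `G`. The blocks
partition `D` as the half-open intervals between successive points of `G ∪ {0}` partition the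
indices; defined in this way they need neither predecessors nor suprema in `G`. -/
def block {W L : Type u} [LinearOrder W] (G : Set W) (D : Set L) (ρ : L → W) (i : W) : Set L :=
  {x | x ∈ D ∧ ∀ δ ∈ G, ρ x < δ ↔ i < δ}

/-- Colourings of the blocks can be glued if every member of `K` inside `D` contains a member of `K`
that lies in one block. -/
theorem exists_isTotalColouring_of_blocks {W L Y : Type u} [LinearOrder W] (K : Set (Set L))
    (G : Set W) (D : Set L) (ρ : L → W)
    (hcol : ∀ i, ∃ c : L → Y, IsTotalColouring K (block G D ρ i) c)
    (hK : ∀ b ∈ K, b ⊆ D → ∃ i, ∃ b' ∈ K, b' ⊆ b ∧ b' ⊆ block G D ρ i) :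
    ∃ c : L → Y, IsTotalColouring K D c := by
  have hcol' : ∀ S : Set L, ∃ c : L → Y, (∃ i, S = block G D ρ i) → IsTotalColouring K S c := by
    intro S
    by_cases h : ∃ i, S = block G D ρ i
    · obtain ⟨i, rfl⟩ := h
      exact (hcol i).imp fun c hc _ => hc
    · rcases isEmpty_or_nonempty W with hW | ⟨⟨i⟩⟩
      · refine ⟨fun x => isEmptyElim (ρ x), fun h' => (h h').elim⟩
      · exact (hcol i).imp fun c _ h' => (h h').elim
  choose col hcolS using hcol'
  refine ⟨fun x => col (block G D ρ (ρ x)) x, fun b hb hbD => ?_⟩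
  obtain ⟨i, b', hb', hbb', hblock⟩ := hK b hb hbD
  have hone := hcolS _ ⟨i, rfl⟩ b' hb' hblock
  refine eq_univ_of_univ_subset (hone ▸ ?_)
  rintro _ ⟨x, hx, rfl⟩
  refine ⟨x, hbb' hx, ?_⟩
  -- Blocks that meet are equal as sets, so the chosen colouring is the one of `block G D ρ i`.
  have : block G D ρ (ρ x) = block G D ρ i := by
    ext y
    exact and_congr_right fun _ => forall₂_congr fun δ hδ => by rw [(hblock hx).2 δ hδ]
  simp only [this]

theorem mk_block_lt {μ : Cardinal.{u}} {L : Type u} {G : Set (Pts μ)} {D : Set L} {ρ : L → Pts μ}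
    (hρ : InjOn ρ D) {i δ : Pts μ} (hδ : δ ∈ G) (hi : i < δ) : #(block G D ρ i) < μ := by
  refine lt_of_le_of_lt ?_ (mk_Iio_pts_lt δ)
  exact mk_le_of_injective (f := fun x => (⟨ρ x, (x.2.2 δ hδ).2 hi⟩ : Iio δ)) fun x y h =>
    Subtype.ext (hρ x.2.1 y.2.1 (congrArg Subtype.val h))

theorem exists_least_index {W L : Type u} [LinearOrder W] [WellFoundedLT W] [Nonempty W]
    (h : W → L) : ∃ ρ : L → W, (∀ x ∈ range h, h (ρ x) = x) ∧ ∀ i, ρ (h i) ≤ i := by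
  classical
  have : ∀ x, ∃ i, x ∈ range h → IsLeast {i | h i = x} i := fun x => by
    by_cases hx : x ∈ range h
    · exact ⟨_, fun _ => ⟨wellFounded_lt.min_mem {i | h i = x} hx,
        fun _ hy => wellFounded_lt.min_le hy⟩⟩
    · exact ⟨Classical.arbitrary W, fun h => (hx h).elim⟩
  choose ρ hρ using this
  exact ⟨ρ, fun x hx => (hρ x hx).1, fun i => (hρ _ ⟨i, rfl⟩).2 rfl⟩

/-! ### Closures of small sets and caught copies -/

/-- The union of the values of the partial function `cl` at the small subsets of `X`. -/
def closureHull {lam θ : Cardinal.{u}} (cl : SmallSets lam θ →. Set (Pts lam)) (X : Set (Pts lam)) :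
    Set (Pts lam) :=
  {x | ∃ a : SmallSets lam θ, a.1 ⊆ X ∧ ∃ d ∈ cl a, x ∈ d}

theorem mk_closureHull_le {lam χ κ θ : Cardinal.{u}} (hχ : ℵ₀ ≤ χ) (hκχ : κ ≤ χ)
    (hpow : (2 : Cardinal.{u}) ^< θ ≤ χ) {cl : SmallSets lam θ →. Set (Pts lam)}
    (hcl : ∀ a, ∀ d ∈ cl a, #d ≤ κ) {X : Set (Pts lam)} (hX : #X < θ) :
    #(closureHull cl X) ≤ χ := by
  let d : 𝒫 X → Set (Pts lam) := fun a => {x | ∃ h : #a.1 < θ, ∃ d ∈ cl ⟨a.1, h⟩, x ∈ d}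
  have hd : ∀ a, #(d a) ≤ χ := fun a => by
    by_cases h : ∃ h : #a.1 < θ, ∃ e, e ∈ cl ⟨a.1, h⟩
    · obtain ⟨h, e, he⟩ := h
      refine (mk_le_mk_of_subset ?_).trans ((hcl _ e he).trans hκχ)
      rintro x ⟨_, e', he', hx⟩
      rwa [Part.mem_unique he he']
    · have : d a = ∅ := eq_empty_of_forall_notMem fun x ⟨h1, e, he, _⟩ => h ⟨h1, e, he⟩
      simp [this]
  have hsub : closureHull cl X ⊆ ⋃ a, d a := by
    rintro x ⟨a, haX, e, he, hx⟩
    exact mem_iUnion.2 ⟨⟨a.1, haX⟩, a.2, e, he, hx⟩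
  refine (mk_le_mk_of_subset hsub).trans (mk_iUnion_le_sum_mk.trans ?_)
  refine (sum_le_sum _ _ hd).trans ?_
  rw [sum_const']
  refine mul_le_of_le hχ ?_ le_rfl
  rw [mk_powerset]
  exact powerlt_le.1 hpow _ hX

/-- The approximating system, applied to the indices of the points `f i`, yields a member of `T.K`
that `f` maps into one block: the block of the point `α` at which `ρ ∘ f` is caught. -/
theorem exists_mem_subset_block {lam μ κ θ : Cardinal.{u}}
    {cl : SmallSets lam θ →. Set (Pts lam)}
    {C : Set (Pts μ)} {P : Pts μ → Set (Set (Pts μ))} {T : Triple κ θ}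
    (hT : Catches T.I₀ T.I₁ C P) {G : Set (Pts μ)} (hGC : G ⊆ C) {h : Pts μ → Pts lam}
    (hh : ∀ δ ∈ G, ∀ α ∈ C, α < δ → ∀ c ∈ P α, closureHull cl (h '' c) ⊆ h '' Iio δ)
    {ρ : Pts lam → Pts μ} (hρ : ∀ x ∈ range h, h (ρ x) = x) (hρle : ∀ i, ρ (h i) ≤ i)
    {f : Pts κ → Pts lam} (hf : Injective f) (hfh : ∀ i, f i ∈ range h)
    (hfcl : ∀ a : SmallSets κ θ,
      ∃ d ∈ cl ⟨f '' a.1, mk_image_le.trans_lt a.2⟩, f '' T.cl a ⊆ d) :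
    ∃ i, ∃ b ∈ T.K, f '' b ⊆ block G (range h) ρ i := by
  have hinj : Injective (ρ ∘ f) := fun i i' hii' => hf (by
    rw [← hρ _ (hfh i), ← hρ _ (hfh i')]
    exact congrArg h hii')
  obtain ⟨α, hα, ⟨c, hc, ⟨a, b⟩, ⟨hb, hasmall, hbcl⟩, hac, hαb⟩ |
    ⟨⟨a, b⟩, ⟨hb, -⟩, -, γ, hγ, hbγ⟩⟩ := hT (ρ ∘ f) hinj
  · -- Clause (a): `f '' b` lies in `cl (f '' a)` with `f '' a ⊆ h '' c`, so its points are enumerated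
    -- before every `δ ∈ G` above `α`.
    refine ⟨α, b, hb, ?_⟩
    rintro _ ⟨i, hi, rfl⟩
    refine ⟨hfh i, fun δ hδ => ⟨(hαb i hi).trans_lt, fun hαδ => ?_⟩⟩
    obtain ⟨d, hd, hfd⟩ := hfcl ⟨a, hasmall⟩
    have hfa : f '' a ⊆ h '' c := by
      rintro _ ⟨j, hj, rfl⟩
      exact ⟨ρ (f j), hac j hj, hρ _ (hfh j)⟩
    obtain ⟨j, hj, hjf⟩ := hh δ hδ α hα hαδ c hc
      ⟨⟨f '' a, mk_image_le.trans_lt hasmall⟩, hfa, d, hd, hfd ⟨i, hbcl hi, rfl⟩⟩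
    rw [← hjf]
    exact (hρle j).trans_lt hj
  · -- Clause (b): the indices lie between `α` and its successor in `C`, and `G ⊆ C`.
    refine ⟨α, b, hb, ?_⟩
    rintro _ ⟨i, hi, rfl⟩
    exact ⟨hfh i, fun δ hδ => ⟨(hbγ i hi).1.trans_lt, fun hαδ =>
      (hbγ i hi).2.trans_le (hγ.2 ⟨hGC hδ, hαδ⟩)⟩⟩

end ClosureColouring

open ClosureColouring Set Function in
theorem lemma3p2 (lam χ κ θ σ : Cardinal.{u})
    (hθ : ℵ₀ ≤ θ) (hσ : ℵ₀ ≤ σ) (hθκ : θ ≤ κ) (hκχ : κ ≤ χ) (hχlam : χ < lam)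
    -- `2 ^ τ ≤ χ` for every cardinal `τ < θ`
    (hpow : (2 : Cardinal.{u}) ^< θ ≤ χ)
    -- `K ⊆ [lam]^{≤κ}` and `cl` is a partial function from `[lam]^{<θ}` to `K`
    (K : Set (Set (ClosureColouring.Pts lam))) (hK : ∀ b ∈ K, #b ≤ κ)
    (cl : ClosureColouring.SmallSets lam θ →. Set (ClosureColouring.Pts lam))
    (hcl : ∀ a, ∀ d ∈ cl a, d ∈ K)
    -- the local closure data
    (𝒦 : Set (ClosureColouring.Triple κ θ))
    (hcopy : ∀ b ∈ K, ∃ T ∈ 𝒦, ∃ f : ClosureColouring.Pts κ → ClosureColouring.Pts lam,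
      Function.Injective f ∧ (∀ i, f i ∈ b) ∧
      (∀ b' ∈ T.K, f '' b' ∈ K) ∧
      ∀ a' : ClosureColouring.SmallSets κ θ,
        ∃ d ∈ cl ⟨f '' a'.1, mk_image_le.trans_lt a'.2⟩, f '' T.cl a' ⊆ d)
    -- small sets have colourings
    (hsmall : ∀ A : Set (ClosureColouring.Pts lam), #A ≤ χ →
      ∃ c : A → ClosureColouring.Pts σ, ClosureColouring.IsColouring K A c)
    (happrox : ∀ μ : Cardinal.{u}, χ < μ → μ ≤ lam → ClosureColouring.IsApproximate μ 𝒦) :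
    ∃ c : ↥(Set.univ : Set (ClosureColouring.Pts lam)) → ClosureColouring.Pts σ,
      ClosureColouring.IsColouring K Set.univ c := by
  have hχ : ℵ₀ ≤ χ := (hθ.trans hθκ).trans hκχ
  have : Nonempty (Pts σ) := by
    rw [← mk_ne_zero_iff, mk_ord_toType]
    exact (aleph0_pos.trans_le hσ).ne'
  have : Nonempty (Pts lam) := by
    rw [← mk_ne_zero_iff, mk_ord_toType]
    exact (bot_le.trans_lt hχlam).ne'
  suffices H : ∀ (μ : Cardinal.{u}) (A : Set (Pts lam)), #A = μ →
      ∃ c : Pts lam → Pts σ, IsTotalColouring K A c from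
    exists_isColouring_iff.2 (H _ Set.univ rfl)
  intro μ
  induction μ using WellFoundedLT.induction with
  | ind μ ih =>
  intro A hA
  rcases le_or_gt μ χ with hμ | hμ
  · exact exists_isColouring_iff.1 (hsmall A (hA.trans_le hμ))
  have hμlam : μ ≤ lam := by
    rw [← hA]
    exact (mk_set_le A).trans_eq (mk_ord_toType lam)
  have : Nonempty (Pts μ) := by
    rw [← mk_ne_zero_iff, mk_ord_toType]
    exact (bot_le.trans_lt hμ).ne'
  obtain ⟨C, P, hCP, hcatch⟩ := happrox μ hμ hμlam
  obtain ⟨a, ha⟩ := exists_subset_range (ι := Pts μ) A (hA.trans (mk_ord_toType μ).symm).le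
  obtain ⟨h, hah, hh⟩ := exists_closed_enumeration hχ hμ hCP (closureHull cl)
    (fun X => mk_closureHull_le hχ hκχ hpow fun a d hd => hK d (hcl a d hd)) a
  obtain ⟨ρ, hρ, hρle⟩ := exists_least_index h
  have hρinj : InjOn ρ (range h) := fun x hx y hy hxy => by rw [← hρ x hx, ← hρ y hy, hxy]
  obtain ⟨c, hc⟩ := exists_isTotalColouring_of_blocks (Y := Pts σ) K (goodPoints χ C) (range h) ρ
    (fun i => by
      obtain ⟨δ, hδ, hi⟩ := exists_goodPoint_gt hχ hμ hCP.isClub.isCofinal i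
      exact ih _ (mk_block_lt hρinj hδ hi) _ rfl)
    (fun b hb hbh => by
      obtain ⟨T, hT, f, hf, hfb, hfK, hfcl⟩ := hcopy b hb
      obtain ⟨i, b', hb', hi⟩ := exists_mem_subset_block (hcatch T hT)
        (fun δ hδ => hδ.1) hh hρ hρle hf (fun i => hbh (hfb i)) hfcl
      exact ⟨i, f '' b', hfK b' hb', image_subset_iff.2 fun j _ => hfb j, hi⟩)
  exact ⟨c, fun b hb hbA => hc b hb (hbA.trans (ha.trans hah))⟩
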